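/- Let $B_3=\langle\sigma_1,\sigma_2\mid\sigma_1\sigma_2\sigma_1=\sigma_2\sigma_1\sigma_2\rangle$ be the braid group on three strands, where the generators $\sigma_1,\sigma_2$ are negative crossings, and let $C=(\sigma_1\sigma_2)^3$ be the full twist. For a link $K$ in $S^3$ with Jones polynomial (normalized to be $1$ on the unknot, so that $J_K(t)=(-A)^{-3w(D)}\langle D\rangle|_{A=t^{-1/4}}$ for every diagram $D$ of $K$ with writhe $w(D)$ and Kauffman bracket $\langle D\rangle$) $$J_K(t)=\alpha_K t^{M(K)}+\beta_K t^{M(K)-1}+\cdots+\beta'_K t^{m(K)+1}+\alpha'_K t^{m(K)},$$ where $M(K)$ and $m(K)$ are the highest and the lowest power of $t$ in $J_K(t)$, put $$\zeta_K=\begin{cases}\beta_K&\text{if }|\alpha_K|=1,\\0&\text{otherwise,}\end{cases}\qquad \zeta'_K=\begin{cases}\beta'_K&\text{if }|\alpha'_K|=1,\\0&\text{otherwise.}\end{cases}$$ Let $k$ be an integer, let $s\ge 1$ and $p_1,\dots,p_s,q_1,\dots,q_s\ge 1$ be integers, and let $K_b$ be the closure of a 3-braid $b\in B_3$ that is equal,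 or more generally conjugate, to the generic braid $$C^k\sigma_1^{p_1}\sigma_2^{-q_1}\cdots\sigma_1^{p_s}\sigma_2^{-q_s}.$$ Then $$s-1\le\max\{|\zeta_{K_b}|,|\zeta'_{K_b}|\}\le s+1 .$$ -/

import Mathlib

open scoped LaurentPolynomial

noncomputable section

namespace ThreeBraid

/-! ### The braid group on three strands -/

/-- The Artin relation `σ₁ σ₂ σ₁ = σ₂ σ₁ σ₂`, as a set of one relator in the free group on two
letters; the letter `0` is `σ₁` and the letter `1` is `σ₂`. -/
def artinRels : Set (FreeGroup (Fin 2)) :=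
  {FreeGroup.of 0 * FreeGroup.of 1 * FreeGroup.of 0 *
    (FreeGroup.of 1 * FreeGroup.of 0 * FreeGroup.of 1)⁻¹}

/-- The braid group `B₃`. -/
abbrev BraidGroup : Type := PresentedGroup artinRels

/-- The generator `σ₁` of `B₃`. -/
def sigma1 : BraidGroup := PresentedGroup.of 0

/-- The generator `σ₂` of `B₃`. -/
def sigma2 : BraidGroup := PresentedGroup.of 1

/-- The full twist `C = (σ₁ σ₂)³`. -/
def fullTwist : BraidGroup := (sigma1 * sigma2) ^ 3

/-- The braid `C^k σ₁^{p₁} σ₂^{-q₁} ⋯ σ₁^{pₛ} σ₂^{-qₛ}`. -/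
def genericBraid (k : ℤ) {s : ℕ} (p q : Fin s → ℕ) : BraidGroup :=
  fullTwist ^ k *
    (List.ofFn fun i : Fin s => sigma1 ^ (p i : ℤ) * sigma2 ^ (-(q i : ℤ))).prod

/-- Braid words: the letter `(i, true)` is the generator with index `i` (`σ₁` for `i = 0`, `σ₂` for
`i = 1`), and `(i, false)` is its inverse. A braid word is the same as a braid diagram on three
strands: the `j`-th letter is a crossing between the adjacent strand positions `i` and `i + 1`. -/
abbrev Word : Type := List (Fin 2 × Bool)

/-- The braid represented by a word. -/
def Word.toBraid (w : Word) : BraidGroup := PresentedGroup.mk artinRels (FreeGroup.mk w)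

/-! ### The Kauffman bracket of the closure of a braid word

The closed braid diagram of a word of length `n` is cut along `n + 1` horizontal levels
`0, 1, …, n`; the `j`-th crossing lies between the levels `j` and `j + 1`, and each level carries
three points, one on each strand. Closing the braid joins the three points of level `n` to those of
level `0`. All strands are oriented in the same direction. -/

/-- A choice of a resolution at each crossing: `true` is the `A`-resolution and `false` is the
`B`-resolution. -/
abbrev Word.State (w : Word) : Type := Fin w.length → Bool

/-- Whether the chosen resolution of the `j`-th crossing is the horizontal one (a cup and a cap), as
opposed to the vertical one (two parallel strands). The generators `σ₁`, `σ₂` are negative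
crossings, for which the `A`-resolution is the horizontal one and the `B`-resolution is the one that
respects the orientation of the strands; at a positive crossing the roles are exchanged. -/
def Word.IsHorizontal (w : Word) (S : w.State) (j : Fin w.length) : Prop :=
  S j = (w.get j).2

/-- The arcs of the crossing-free diagram that arises from the closed braid diagram by the
resolutions of the state `S`, each given by its two end points. -/
inductive Word.Arc (w : Word) (S : w.State) :
    Fin (w.length + 1) × Fin 3 → Fin (w.length + 1) × Fin 3 → Prop
  /-- the closing arcs -/
  | closing (x : Fin 3) : Word.Arc w S (Fin.last w.length, x) (0, x)
  /-- the strand that does not take part in the `j`-th crossing -/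
  | strand (j : Fin w.length) (x : Fin 3) (hl : x ≠ (w.get j).1.castSucc)
      (hr : x ≠ (w.get j).1.succ) : Word.Arc w S (j.castSucc, x) (j.succ, x)
  /-- the left arc of a vertical resolution -/
  | left (j : Fin w.length) (h : ¬ w.IsHorizontal S j) :
      Word.Arc w S (j.castSucc, (w.get j).1.castSucc) (j.succ, (w.get j).1.castSucc)
  /-- the right arc of a vertical resolution -/
  | right (j : Fin w.length) (h : ¬ w.IsHorizontal S j) :
      Word.Arc w S (j.castSucc, (w.get j).1.succ) (j.succ, (w.get j).1.succ)
  /-- the arc of a horizontal resolution with both ends on level `j` -/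
  | cap (j : Fin w.length) (h : w.IsHorizontal S j) :
      Word.Arc w S (j.castSucc, (w.get j).1.castSucc) (j.castSucc, (w.get j).1.succ)
  /-- the arc of a horizontal resolution with both ends on level `j + 1` -/
  | cup (j : Fin w.length) (h : w.IsHorizontal S j) :
      Word.Arc w S (j.succ, (w.get j).1.castSucc) (j.succ, (w.get j).1.succ)

/-- The number of circles of the crossing-free diagram of the state `S`: the number of classes of
points under the equivalence relation generated by the arcs. It is at least `1`. -/
def Word.circles (w : Word) (S : w.State) : ℕ := Nat.card (Quot (w.Arc S))

/-- The Kauffman bracket `⟨D⟩ ∈ ℤ[A, A⁻¹]` of the closure `D` of a braid word, with the variable `A`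
written `T 1`: the sum over all states of `A^{a - b} (-A² - A⁻²)^{c - 1}`, where `a` and `b` are the
numbers of `A`- and `B`-resolutions and `c` is the number of circles. The bracket of a
crossing-free circle is `1`. -/
def Word.bracket (w : Word) : ℤ[T;T⁻¹] :=
  ∑ S : w.State, LaurentPolynomial.T (∑ j, if S j then 1 else -1) *
    (-LaurentPolynomial.T 2 - LaurentPolynomial.T (-2)) ^ (w.circles S - 1)

/-- The writhe of the closure of a braid word: every `σᵢ` is a negative crossing and every `σᵢ⁻¹` is
a positive crossing. -/
def Word.writhe (w : Word) : ℤ := (w.map fun l => if l.2 then (-1 : ℤ) else 1).sum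

/-! ### The Jones polynomial and its outer coefficients -/

/-- Polynomials `∑ aᵣ t^r` with integer coefficients and rational exponents `r`. (The Jones
polynomial of a link with an even number of components has exponents in `1/2 + ℤ`.) -/
abbrev FracPoly : Type := AddMonoidAlgebra ℤ ℚ

/-- The Jones polynomial `J(t) = (-A)^{-3 w(D)} ⟨D⟩`, evaluated at `A = t^{-1/4}`, of the link that
is the closure `D` of a braid word; the monomial `A^n` becomes `t^{-n/4}`. -/
def Word.jones (w : Word) : FracPoly :=
  AddMonoidAlgebra.mapDomain (fun n : ℤ => -(n : ℚ) / 4)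
    (LaurentPolynomial.C (((-1 : ℤˣ) ^ (-3 * w.writhe) : ℤˣ) : ℤ) *
      LaurentPolynomial.T (-3 * w.writhe) * w.bracket)

/-- The highest power `M` of `t` in `J` (with the value `0` if `J = 0`). -/
def topDeg (J : FracPoly) : ℚ :=
  if h : J.coeff.support.Nonempty then J.coeff.support.max' h else 0

/-- The lowest power `m` of `t` in `J` (with the value `0` if `J = 0`). -/
def botDeg (J : FracPoly) : ℚ :=
  if h : J.coeff.support.Nonempty then J.coeff.support.min' h else 0

/-- `ζ`: the coefficient `β` of `t^{M-1}` if the coefficient `α` of `t^M` is `±1`, and `0`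
otherwise. -/
def zeta (J : FracPoly) : ℤ :=
  if |J.coeff (topDeg J)| = 1 then J.coeff (topDeg J - 1) else 0

/-- `ζ'`: the coefficient `β'` of `t^{m+1}` if the coefficient `α'` of `t^m` is `±1`, and `0`
otherwise. -/
def zeta' (J : FracPoly) : ℤ :=
  if |J.coeff (botDeg J)| = 1 then J.coeff (botDeg J + 1) else 0

end ThreeBraid

end

/-! Up to a sign and a power of `t`, the Jones polynomial of a closed 3-braid is `g = tr(Burau) - T
- T⁻¹` at `T = -t⁻¹` (`Word.bracket_eq_burauJones`, `Word.jones_eq`). This follows from the state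
sum: the Markov trace of the Temperley–Lieb algebra on three strands is a combination of two
characters, one of them the trace of a two-dimensional representation that is Burau in disguise
(`Word.loopValue_pow_circles`, `letterMatrix_eq`).

The trace is a conjugacy invariant and `C` acts by the scalar `-T³`, so `g = (-1)^k T^(3k) Y - T -
T⁻¹`, where `Y` is the trace of the alternating product. With `Q = ∑ qᵢ` and `P = ∑ pᵢ`, `Y` begins
with `T^(-Q) + s T^(-Q+1)` and, read from the top, with `T^P + s T^(P-1)`
(`coeff_trace_prod_lowMatrix`, `coeff_trace_prod_highMatrix`).

If `3k - Q ≤ -2`, the lower end of `g` is that of the shifted `Y`, and `T⁻¹` changes the second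
coefficient by at most one, so its absolute value lies between `s - 1` and `s + 1`. Otherwise that
end contributes at most `s + 1` (`exists_lowest`). The upper end behaves in the same way, and for `s
≥ 2` at least one end is of the first kind because `P + Q ≥ 2s`. -/

open scoped LaurentPolynomial Polynomial

noncomputable section

namespace ThreeBraid

open LaurentPolynomial
open Polynomial (toLaurent toLaurent_X_pow)

/-! ### Words in the Temperley–Lieb generators -/

/-- In the Temperley–Lieb monoid on three strands every word is a power of the loop value times one
of the five crossing-free diagrams. -/
theorem exists_temperleyLieb_normalForm (l : List (Option (Fin 2))) :
    ∃ (j : ℕ) (r : List (Fin 2)), r ∈ [[], [0], [1], [0, 1], [1, 0]] ∧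
      ∀ {M : Type} [Monoid M] (δ : M) (u : Fin 2 → M), (∀ x, Commute δ x) →
        (∀ i, u i * u i = δ * u i) → (u 0 * u 1 * u 0 = u 0) → (u 1 * u 0 * u 1 = u 1) →
        (l.map fun o => o.elim 1 u).prod = δ ^ j * (r.map u).prod := by
  induction l with
  | nil => exact ⟨0, [], by simp, by simp⟩
  | cons o l ih =>
    obtain ⟨j, r, hr, h⟩ := ih
    have key : ∃ (j' : ℕ) (r' : List (Fin 2)), r' ∈ [[], [0], [1], [0, 1], [1, 0]] ∧
      ∀ {M : Type} [Monoid M] (δ : M) (u : Fin 2 → M), (∀ x, Commute δ x) →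
        (∀ i, u i * u i = δ * u i) → (u 0 * u 1 * u 0 = u 0) → (u 1 * u 0 * u 1 = u 1) →
        o.elim 1 u * (r.map u).prod = δ ^ j' * (r'.map u).prod := by
      rcases o with _ | i
      · exact ⟨0, r, hr, by simp⟩
      -- A generator times each of the five normal forms; a factor `δ` splits off exactly when a
      -- letter is doubled.
      · fin_cases i <;> fin_cases hr
        · exact ⟨0, [0], by simp, by simp⟩
        · exact ⟨1, [0], by simp, by simp +contextual⟩
        · exact ⟨0, [0, 1], by simp, by simp⟩
        · refine ⟨1, [0, 1], by simp, fun δ u _ h _ _ => ?_⟩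
          simp [← mul_assoc, h]
        · refine ⟨0, [0], by simp, fun δ u _ h h' _ => ?_⟩
          simp [← mul_assoc, h']
        · exact ⟨0, [1], by simp, by simp⟩
        · exact ⟨0, [1, 0], by simp, by simp⟩
        · exact ⟨1, [1], by simp, by simp +contextual⟩
        · refine ⟨0, [1], by simp, fun δ u _ h _ h' => ?_⟩
          simp [← mul_assoc, h']
        · refine ⟨1, [1, 0], by simp, fun δ u _ h _ _ => ?_⟩
          simp [← mul_assoc, h]
    obtain ⟨j', r', hr', h'⟩ := key
    refine ⟨j + j', r', hr', fun δ u hδ h1 h2 h3 => ?_⟩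
    rw [List.map_cons, List.prod_cons, h δ u hδ h1 h2 h3, ← mul_assoc,
      ← ((hδ _).pow_left j).eq, mul_assoc, h' δ u hδ h1 h2 h3, pow_add, mul_assoc]

/-! ### Counting circles by colourings -/

/-- An entry of a product of matrices is a sum over paths. -/
theorem matrix_prod_apply_eq_sum_paths {V R : Type*} [Fintype V] [DecidableEq V] [CommSemiring R]
    {n : ℕ} (M : Fin n → Matrix V V R) (u v : V) :
    (List.ofFn M).prod u v = ∑ f : Fin (n + 1) → V,
      if f 0 = u ∧ f (Fin.last n) = v then ∏ j, M j (f j.castSucc) (f j.succ) else 0 := by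
  induction n generalizing u with
  | zero =>
    rw [← (Equiv.funUnique (Fin 1) V).symm.sum_comp]
    simp [Matrix.one_apply, ite_and]
  | succ n ih =>
    rw [List.ofFn_succ, List.prod_cons, Matrix.mul_apply,
      ← (Fin.consEquiv fun _ => V).sum_comp, Fintype.sum_prod_type]
    have h : ∀ (x : V) (g : Fin (n + 1) → V),
        (if (Fin.consEquiv fun _ => V) (x, g) 0 = u ∧
            (Fin.consEquiv fun _ => V) (x, g) (Fin.last (n + 1)) = v then
          ∏ j, M j ((Fin.consEquiv fun _ => V) (x, g) j.castSucc)
            ((Fin.consEquiv fun _ => V) (x, g) j.succ) else 0) =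
        if x = u then (if g (Fin.last n) = v then
          M 0 u (g 0) * ∏ j : Fin n, M j.succ (g j.castSucc) (g j.succ) else 0) else 0 := by
      intro x g
      simp only [Fin.consEquiv_apply, Fin.cons_zero, ← Fin.succ_last, Fin.cons_succ,
        Fin.prod_univ_succ, Fin.castSucc_zero, ← Fin.succ_castSucc]
      by_cases hx : x = u <;> simp [hx]
    simp_rw [h]
    rw [Finset.sum_comm]
    simp only [Finset.sum_ite_eq', Finset.mem_univ, if_true]
    simp_rw [ih, Finset.mul_sum]
    rw [Finset.sum_comm]
    refine Finset.sum_congr rfl fun g _ => ?_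
    by_cases hg : g (Fin.last n) = v <;> simp [hg]

/-- The colours of the three points on a level. -/
abbrev LevelColouring : Type := Fin 3 → Bool

/-- Two consecutive levels are coloured compatibly with a pair of parallel strands (`none`) or with
a cap and a cup on the strands `i`, `i + 1` (`some i`). -/
def ColourRel : Option (Fin 2) → LevelColouring → LevelColouring → Prop
  | none, u, v => ∀ x, u x = v x
  | some i, u, v => u i.castSucc = u i.succ ∧ v i.castSucc = v i.succ ∧
      ∀ x, x ≠ i.castSucc → x ≠ i.succ → u x = v x

instance (o : Option (Fin 2)) (u v : LevelColouring) : Decidable (ColourRel o u v) := by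
  cases o <;> unfold ColourRel <;> infer_instance

/-- The transfer matrix that counts compatible colourings of two consecutive levels. -/
def transferMatrix (o : Option (Fin 2)) : Matrix LevelColouring LevelColouring ℕ :=
  fun u v => if ColourRel o u v then 1 else 0

theorem transferMatrix_none : transferMatrix none = 1 := by
  ext u v
  simp [transferMatrix, ColourRel, Matrix.one_apply, funext_iff]

/-- The loop value is 2 here because a closed circle between two levels can be coloured in two ways.
-/
theorem transferMatrix_sq (i : Fin 2) :
    transferMatrix (some i) * transferMatrix (some i) = 2 * transferMatrix (some i) := by
  rw [two_mul]
  revert i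
  decide +kernel

theorem transferMatrix_zero_one_zero :
    transferMatrix (some 0) * transferMatrix (some 1) * transferMatrix (some 0) =
      transferMatrix (some 0) := by
  decide +kernel

theorem transferMatrix_one_zero_one :
    transferMatrix (some 1) * transferMatrix (some 0) * transferMatrix (some 1) =
      transferMatrix (some 1) := by
  decide +kernel

/-- The Temperley–Lieb diagram that replaces a crossing in a state. -/
def Word.resolution (w : Word) (S : w.State) (j : Fin w.length) : Option (Fin 2) :=
  if S j = (w.get j).2 then some (w.get j).1 else none

/-- A colouring of the points by two colours that is constant along arcs is a free choice of a
colour for each circle. Read level by level, such colourings are closed paths for the transfer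
matrices, and the trace closes them up as the closing arcs do. -/
theorem Word.two_pow_circles (w : Word) (S : w.State) :
    2 ^ w.circles S = (List.ofFn fun j => transferMatrix (w.resolution S j)).prod.trace := by
  have : Fintype (Quot (w.Arc S)) := Fintype.ofFinite _
  have e : (Quot (w.Arc S) → Bool) ≃
      {f : Fin (w.length + 1) → LevelColouring // f 0 = f (Fin.last _) ∧
        ∀ j, ColourRel (w.resolution S j) (f j.castSucc) (f j.succ)} :=
    { toFun := fun g => ⟨fun j x => g (Quot.mk _ (j, x)), by
        refine ⟨funext fun x => ?_, fun j => ?_⟩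
        · exact congrArg g (Quot.sound (Word.Arc.closing x)).symm
        · unfold Word.resolution
          split_ifs with h
          · exact ⟨congrArg g (Quot.sound (Word.Arc.cap j h)),
              congrArg g (Quot.sound (Word.Arc.cup j h)),
              fun x hl hr => congrArg g (Quot.sound (Word.Arc.strand j x hl hr))⟩
          · intro x
            by_cases hl : x = (w.get j).1.castSucc
            · subst hl
              exact congrArg g (Quot.sound (Word.Arc.left j h))
            · by_cases hr : x = (w.get j).1.succ
              · subst hr
                exact congrArg g (Quot.sound (Word.Arc.right j h))
              · exact congrArg g (Quot.sound (Word.Arc.strand j x hl hr))⟩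
      invFun := fun f => Quot.lift (fun a => f.1 a.1 a.2) (by
        obtain ⟨f, h0, hf⟩ := f
        intro a b hab
        induction hab with
        | closing x => exact (congrFun h0 x).symm
        | strand j x hl hr =>
          have := hf j
          unfold Word.resolution at this
          split_ifs at this with h
          · exact this.2.2 x hl hr
          · exact this x
        | left j h =>
          have := hf j
          rw [Word.resolution, if_neg (show ¬ S j = (w.get j).2 from h)] at this
          exact this _
        | right j h =>
          have := hf j
          rw [Word.resolution, if_neg (show ¬ S j = (w.get j).2 from h)] at this
          exact this _
        | cap j h =>
          have := hf j
          rw [Word.resolution, if_pos (show S j = (w.get j).2 from h)] at this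
          exact this.1
        | cup j h =>
          have := hf j
          rw [Word.resolution, if_pos (show S j = (w.get j).2 from h)] at this
          exact this.2.1)
      left_inv := fun g => by
        ext a
        induction a using Quot.ind
        rfl
      right_inv := fun f => rfl }
  have hcard : 2 ^ w.circles S = Fintype.card {f : Fin (w.length + 1) → LevelColouring //
      f 0 = f (Fin.last _) ∧ ∀ j, ColourRel (w.resolution S j) (f j.castSucc) (f j.succ)} := by
    classical
    rw [← Fintype.card_congr e, Fintype.card_fun, Fintype.card_bool, Word.circles,
      Nat.card_eq_fintype_card]
  rw [hcard, Fintype.card_subtype, Finset.card_filter, Matrix.trace]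
  simp only [Matrix.diag_apply, matrix_prod_apply_eq_sum_paths]
  rw [Finset.sum_comm]
  refine Finset.sum_congr rfl fun f _ => ?_
  simp only [transferMatrix, Finset.prod_ite_zero, Finset.prod_const_one, Finset.mem_univ,
    true_implies]
  rw [Finset.sum_eq_single (f 0)]
  · simp [ite_and, eq_comm]
  · intro b _ hb
    simp [hb.symm]
  · simp

/-! ### The bracket as a sum of two characters -/

/-- The value `-A² - A⁻²` of a crossing-free circle. -/
def loopValue : ℤ[T;T⁻¹] := -T 2 - T (-2)

/-- The two-dimensional representation of the Temperley–Lieb algebra on three strands. -/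
def tlMatrix : Fin 2 → Matrix (Fin 2) (Fin 2) ℤ[T;T⁻¹] :=
  ![!![loopValue, T (-2); 0, 0], !![0, 0; T 2, loopValue]]

theorem T_two_mul_T_neg_two : (T 2 : ℤ[T;T⁻¹]) * T (-2) = 1 := by
  rw [← T_add]; exact T_zero

theorem T_neg_two_mul_T_two : (T (-2) : ℤ[T;T⁻¹]) * T 2 = 1 := by
  rw [mul_comm, T_two_mul_T_neg_two]

theorem tlMatrix_sq (i : Fin 2) :
    tlMatrix i * tlMatrix i = algebraMap ℤ[T;T⁻¹] _ loopValue * tlMatrix i := by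
  rw [← Algebra.smul_def]
  ext a b
  fin_cases i <;> fin_cases a <;> fin_cases b <;> simp [-T_mul, tlMatrix]

theorem tlMatrix_zero_one_zero : tlMatrix 0 * tlMatrix 1 * tlMatrix 0 = tlMatrix 0 := by
  ext i j
  fin_cases i <;> fin_cases j <;> simp [-T_mul, tlMatrix, T_neg_two_mul_T_two]

theorem tlMatrix_one_zero_one : tlMatrix 1 * tlMatrix 0 * tlMatrix 1 = tlMatrix 1 := by
  ext i j
  fin_cases i <;> fin_cases j <;> simp [-T_mul, tlMatrix, T_two_mul_T_neg_two]

/-- Both sides are traces on the Temperley–Lieb algebra, so they need only be compared on the five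
crossing-free diagrams. The first summand is the character that kills the generators; its weight `δ²
- 2` is forced by the identity diagram, where the left side is `δ²` and the matrix trace is 2. -/
theorem Word.loopValue_pow_circles (w : Word) (S : w.State) :
    loopValue ^ (w.circles S - 1) =
      (loopValue ^ 2 - 2) * (List.ofFn fun j => (w.resolution S j).elim (1 : ℤ[T;T⁻¹]) 0).prod +
        (List.ofFn fun j => (w.resolution S j).elim 1 tlMatrix).prod.trace := by
  -- The pair `j`, `r` does not depend on the monoid, so it serves the transfer matrices, the
  -- two-dimensional representation and the zero character at once.
  obtain ⟨j, r, hr, h⟩ := exists_temperleyLieb_normalForm (List.ofFn (w.resolution S))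
  have hc := w.two_pow_circles S
  have h1 := h (2 : Matrix LevelColouring LevelColouring ℕ) (fun i => transferMatrix (some i))
    (fun x => Nat.cast_commute 2 x) transferMatrix_sq transferMatrix_zero_one_zero
    transferMatrix_one_zero_one
  have h2 := h (algebraMap ℤ[T;T⁻¹] (Matrix (Fin 2) (Fin 2) ℤ[T;T⁻¹]) loopValue) tlMatrix
    (fun x => Algebra.commutes _ x) tlMatrix_sq tlMatrix_zero_one_zero tlMatrix_one_zero_one
  have h3 := h loopValue (fun _ => (0 : ℤ[T;T⁻¹])) (fun x => mul_comm _ _) (by simp) (by simp)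
    (by simp)
  have h0 : (fun o : Option (Fin 2) => o.elim 1 fun i => transferMatrix (some i)) =
      transferMatrix := by
    funext o
    cases o
    · exact transferMatrix_none.symm
    · rfl
  rw [h0, List.map_ofFn] at h1
  rw [List.map_ofFn] at h2 h3
  simp only [Function.comp_def] at h1 h2 h3
  have h3' : (List.ofFn fun j => (w.resolution S j).elim (1 : ℤ[T;T⁻¹]) 0).prod = _ := h3
  rw [h1] at hc
  rw [h2, h3', ← map_pow, ← Algebra.smul_def, Matrix.trace_smul, smul_eq_mul]
  rw [show (2 : Matrix LevelColouring LevelColouring ℕ) = ((2 : ℕ) : Matrix _ _ ℕ) from rfl,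
    ← Nat.cast_pow, ← nsmul_eq_mul, Matrix.trace_smul, smul_eq_mul] at hc
  -- The closure of the diagram `r` has `t + 1` circles: 3 for the identity, 2 for a single
  -- generator, 1 for a product of two.
  have key : ∀ t, (r.map fun i => transferMatrix (some i)).prod.trace = 2 ^ (t + 1) →
      w.circles S - 1 = j + t := by
    intro t ht
    rw [ht, ← pow_add] at hc
    have := Nat.pow_right_injective le_rfl hc
    omega
  fin_cases hr
  · rw [key 2 (by decide +kernel)]
    simp
    ring
  · rw [key 1 (by decide +kernel)]
    simp [-T_mul, tlMatrix, Matrix.trace_fin_two, pow_succ]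
  · rw [key 1 (by decide +kernel)]
    simp [-T_mul, tlMatrix, Matrix.trace_fin_two, pow_succ]
  · rw [key 0 (by decide +kernel)]
    simp [-T_mul, tlMatrix, Matrix.trace_fin_two, T_neg_two_mul_T_two]
  · rw [key 0 (by decide +kernel)]
    simp [-T_mul, tlMatrix, Matrix.trace_fin_two, T_two_mul_T_neg_two]

/-- A state sum of ordered products is an ordered product of sums. -/
theorem sum_states_prod {R B : Type*} [CommRing R] [Ring B] [Algebra R B]
    (c : Bool → R) (g : Fin 2 × Bool → Bool → B) (w : Word) :
    ∑ S : w.State, (∏ j, c (S j)) • (List.ofFn fun j => g (w.get j) (S j)).prod =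
      (w.map fun l => ∑ b, c b • g l b).prod := by
  induction w with
  | nil =>
    simp only [List.map_nil, List.prod_nil]
    rw [Fintype.sum_eq_single (fun j => j.elim0)]
    · simp
    · intro S hS
      exact absurd (funext fun j => j.elim0) hS
  | cons a w ih =>
    rw [List.map_cons, List.prod_cons, ← ih]
    refine ((Fin.consEquiv (fun _ : Fin (w.length + 1) => Bool)).sum_comp
      (fun S : Word.State (a :: w) => (∏ j, c (S j)) •
        (List.ofFn fun j => g (List.get (a :: w) j) (S j)).prod)).symm.trans ?_
    rw [Fintype.sum_prod_type, Finset.sum_mul]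
    refine Finset.sum_congr rfl fun b _ => ?_
    rw [Finset.mul_sum]
    refine Finset.sum_congr rfl fun S _ => ?_
    have h1 : ∏ j : Fin (List.length (a :: w)),
        c ((Fin.consEquiv (fun _ : Fin (w.length + 1) => Bool)) (b, S) j) =
        c b * ∏ j, c (S j) := by
      refine (Fin.prod_univ_succ (n := w.length) _).trans ?_
      simp
    have h2 : (List.ofFn fun j : Fin (List.length (a :: w)) => g (List.get (a :: w) j)
        ((Fin.consEquiv (fun _ : Fin (w.length + 1) => Bool)) (b, S) j)).prod =
        g a b * (List.ofFn fun j => g (w.get j) (S j)).prod := by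
      refine (congrArg List.prod (List.ofFn_succ (n := w.length))).trans ?_
      simp
    rw [h1, h2, smul_mul_smul_comm]

theorem T_sum {ι : Type*} (s : Finset ι) (f : ι → ℤ) :
    (T (∑ j ∈ s, f j) : ℤ[T;T⁻¹]) = ∏ j ∈ s, T (f j) := by
  classical
  induction s using Finset.induction_on with
  | empty => simp
  | insert a s ha ih => rw [Finset.sum_insert ha, Finset.prod_insert ha, T_add, ih]

/-- The image of a letter in the two-dimensional representation. -/
def letterMatrix (l : Fin 2 × Bool) : Matrix (Fin 2) (Fin 2) ℤ[T;T⁻¹] :=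
  (T (if l.2 then -1 else 1) : ℤ[T;T⁻¹]) • 1 +
    (T (if l.2 then 1 else -1) : ℤ[T;T⁻¹]) • tlMatrix l.1

theorem Word.bracket_eq (w : Word) :
    w.bracket = (T 4 + T (-4)) * T w.writhe + (w.map letterMatrix).prod.trace := by
  have h1 := sum_states_prod (R := ℤ[T;T⁻¹]) (B := ℤ[T;T⁻¹]) (fun b => T (if b then 1 else -1))
    (fun l b => if b = l.2 then 0 else 1) w
  have h2 := sum_states_prod (R := ℤ[T;T⁻¹]) (B := Matrix (Fin 2) (Fin 2) ℤ[T;T⁻¹])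
    (fun b => T (if b then 1 else -1)) (fun l b => if b = l.2 then tlMatrix l.1 else 1) w
  -- Under the zero character only the vertical resolution of each crossing survives, and its
  -- weights multiply to `A` to the writhe.
  have e1 : (w.map fun l => ∑ b : Bool, (T (if b then 1 else -1) : ℤ[T;T⁻¹]) •
      (if b = l.2 then (0 : ℤ[T;T⁻¹]) else 1)).prod = T w.writhe := by
    clear h1 h2
    unfold Word.writhe
    induction w with
    | nil => simp
    | cons a w ih =>
      rw [List.map_cons, List.prod_cons, ih, List.map_cons, List.sum_cons, T_add]
      rcases a with ⟨i, _ | _⟩ <;> simp [-T_mul]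
  have e2 : (fun l : Fin 2 × Bool => ∑ b : Bool, (T (if b then 1 else -1) : ℤ[T;T⁻¹]) •
      (if b = l.2 then tlMatrix l.1 else 1)) = letterMatrix := by
    funext l
    rcases l with ⟨i, _ | _⟩ <;> simp [-T_mul, letterMatrix, add_comm]
  rw [e1] at h1
  rw [e2] at h2
  have e3 : (T 4 + T (-4) : ℤ[T;T⁻¹]) = loopValue ^ 2 - 2 := by
    have h : (T 2 : ℤ[T;T⁻¹]) * T 2 = T 4 := by rw [← T_add]; rfl
    have h' : (T (-2) : ℤ[T;T⁻¹]) * T (-2) = T (-4) := by rw [← T_add]; rfl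
    rw [loopValue, ← h, ← h']
    linear_combination (-2) * T_two_mul_T_neg_two
  rw [← h1, ← h2, e3, Matrix.trace_sum, Finset.mul_sum, ← Finset.sum_add_distrib, Word.bracket]
  refine Finset.sum_congr rfl fun S _ => ?_
  have := w.loopValue_pow_circles S
  rw [show (-T 2 - T (-2) : ℤ[T;T⁻¹]) = loopValue from rfl, this, T_sum, Matrix.trace_smul,
    smul_eq_mul, smul_eq_mul]
  have a1 : ∀ j, (w.resolution S j).elim (1 : ℤ[T;T⁻¹]) 0 =
      if S j = (w.get j).2 then 0 else 1 := by
    intro j; unfold Word.resolution; split_ifs <;> rfl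
  have a2 : ∀ j, (w.resolution S j).elim 1 tlMatrix =
      if S j = (w.get j).2 then tlMatrix (w.get j).1 else 1 := by
    intro j; unfold Word.resolution; split_ifs <;> rfl
  simp only [a1, a2]
  ring

/-! ### The Burau representation -/

theorem T_mul_T_eq_one {m n : ℤ} (h : m + n = 0) : (T m : ℤ[T;T⁻¹]) * T n = 1 := by
  rw [← T_add, h, T_zero]

/-- The reduced Burau matrix of `σ₁`, with parameter `T 1`. -/
def burau1 : (Matrix (Fin 2) (Fin 2) ℤ[T;T⁻¹])ˣ where
  val := !![T 1, 1; 0, 1]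
  inv := !![T (-1), -T (-1); 0, 1]
  val_inv := by
    ext i j
    fin_cases i <;> fin_cases j <;> simp [-T_mul, T_mul_T_eq_one]
  inv_val := by
    ext i j
    fin_cases i <;> fin_cases j <;> simp [-T_mul, T_mul_T_eq_one]

/-- The reduced Burau matrix of `σ₂`, with parameter `T 1`. -/
def burau2 : (Matrix (Fin 2) (Fin 2) ℤ[T;T⁻¹])ˣ where
  val := !![1, 0; -T 1, T 1]
  inv := !![1, 0; 1, T (-1)]
  val_inv := by
    ext i j
    fin_cases i <;> fin_cases j <;> simp [-T_mul, T_mul_T_eq_one]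
  inv_val := by
    ext i j
    fin_cases i <;> fin_cases j <;> simp [-T_mul, T_mul_T_eq_one]

/-- The reduced Burau representation, with parameter `T 1`. -/
def burau : BraidGroup →* (Matrix (Fin 2) (Fin 2) ℤ[T;T⁻¹])ˣ :=
  PresentedGroup.toGroup (f := ![burau1, burau2]) (by
    intro r hr
    rw [artinRels, Set.mem_singleton_iff] at hr
    subst hr
    rw [map_mul, map_inv, mul_inv_eq_one]
    ext i j
    fin_cases i <;> fin_cases j <;> simp [-T_mul, burau1, burau2])

theorem burau_sigma1 : burau sigma1 = burau1 := PresentedGroup.toGroup.of _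

theorem burau_sigma2 : burau sigma2 = burau2 := PresentedGroup.toGroup.of _

theorem burau_fullTwist :
    (burau fullTwist : Matrix (Fin 2) (Fin 2) ℤ[T;T⁻¹]) = (-T 3 : ℤ[T;T⁻¹]) • 1 := by
  have h : (T 3 : ℤ[T;T⁻¹]) = T 1 ^ 3 := by rw [T_pow]; rfl
  rw [fullTwist, map_pow, map_mul, burau_sigma1, burau_sigma2, h]
  ext i j
  fin_cases i <;> fin_cases j <;> simp [-T_mul, -T_pow, burau1, burau2, pow_succ]

theorem burau_fullTwist_zpow (k : ℤ) :
    ((burau fullTwist ^ k : (Matrix (Fin 2) (Fin 2) ℤ[T;T⁻¹])ˣ) : Matrix (Fin 2) (Fin 2) ℤ[T;T⁻¹]) =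
      (((-1 : ℤˣ) ^ k : ℤˣ) : ℤ) • (T (3 * k) : ℤ[T;T⁻¹]) • 1 := by
  have key : ∀ n : ℕ, ((burau fullTwist ^ n : (Matrix (Fin 2) (Fin 2) ℤ[T;T⁻¹])ˣ) :
      Matrix (Fin 2) (Fin 2) ℤ[T;T⁻¹]) =
      (((-1 : ℤˣ) ^ n : ℤˣ) : ℤ) • (T (3 * n) : ℤ[T;T⁻¹]) • 1 := by
    intro n
    rw [Units.val_pow_eq_pow_val, burau_fullTwist, smul_pow, one_pow, neg_pow, T_pow, mul_comm 3,
      Units.val_pow_eq_pow_val, Units.val_neg, Units.val_one]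
    rcases neg_one_pow_eq_or ℤ n with h | h
    · have h' : (-1 : ℤ[T;T⁻¹]) ^ n = 1 := by simpa using congrArg (Int.cast : ℤ → ℤ[T;T⁻¹]) h
      rw [h, h', one_mul, one_smul]
    · have h' : (-1 : ℤ[T;T⁻¹]) ^ n = -1 := by simpa using congrArg (Int.cast : ℤ → ℤ[T;T⁻¹]) h
      rw [h, h', neg_one_mul, neg_one_smul, neg_smul]
  obtain ⟨n, rfl | rfl⟩ := k.eq_nat_or_neg
  · simpa using key n
  · have h : (burau fullTwist ^ (-(n : ℤ))) = (burau fullTwist ^ n)⁻¹ := by simp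
    rw [h]
    refine Units.inv_eq_of_mul_eq_one_right ?_
    rw [key]
    have hs : (((-1 : ℤˣ) ^ n : ℤˣ) : ℤ) * (((-1 : ℤˣ) ^ (-(n : ℤ)) : ℤˣ) : ℤ) = 1 := by
      rw [← Units.val_mul]; simp
    rw [smul_mul_smul_comm, hs, one_smul, smul_mul_smul_comm, T_mul_T_eq_one (by ring), one_smul,
      one_mul]

/-- The polynomial `1 + X + ⋯ + X^{n-1}`. -/
def geomPoly (n : ℕ) : ℤ[X] := ∑ i ∈ Finset.range n, Polynomial.X ^ i

theorem geomPoly_succ (n : ℕ) : geomPoly (n + 1) = geomPoly n + Polynomial.X ^ n :=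
  Finset.sum_range_succ _ n

theorem burau1_pow (p : ℕ) : ((burau1 ^ p : (Matrix (Fin 2) (Fin 2) ℤ[T;T⁻¹])ˣ) :
    Matrix (Fin 2) (Fin 2) ℤ[T;T⁻¹]) = !![T p, toLaurent (geomPoly p); 0, 1] := by
  induction p with
  | zero => simp [geomPoly, Matrix.one_fin_two]
  | succ p ih =>
    rw [pow_succ, Units.val_mul, ih, geomPoly_succ, map_add, toLaurent_X_pow]
    ext i j
    fin_cases i <;> fin_cases j <;> simp [-T_mul, burau1, T_add, add_comm]

theorem burau2_inv_pow (q : ℕ) : ((burau2⁻¹ ^ q : (Matrix (Fin 2) (Fin 2) ℤ[T;T⁻¹])ˣ) :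
    Matrix (Fin 2) (Fin 2) ℤ[T;T⁻¹]) =
      !![1, 0; invert (toLaurent (geomPoly q)), T (-q)] := by
  induction q with
  | zero => simp [geomPoly, Matrix.one_fin_two]
  | succ q ih =>
    rw [pow_succ, Units.val_mul, ih, geomPoly_succ, map_add, map_add,
      toLaurent_X_pow, invert_T]
    ext i j
    fin_cases i <;> fin_cases j <;>
      simp [-T_mul, burau2, ← T_add, add_comm]

/-- The Burau matrix of `σ₁^p σ₂^{-q}`. -/
def syllable (p q : ℕ) : Matrix (Fin 2) (Fin 2) ℤ[T;T⁻¹] :=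
  !![T p + toLaurent (geomPoly p) * invert (toLaurent (geomPoly q)),
    toLaurent (geomPoly p) * T (-q); invert (toLaurent (geomPoly q)), T (-q)]

theorem burau_syllable (p q : ℕ) :
    (burau (sigma1 ^ (p : ℤ) * sigma2 ^ (-(q : ℤ))) : Matrix (Fin 2) (Fin 2) ℤ[T;T⁻¹]) =
      syllable p q := by
  rw [map_mul, map_zpow, map_zpow, burau_sigma1, burau_sigma2, zpow_neg, zpow_natCast,
    zpow_natCast, ← inv_pow, Units.val_mul, burau1_pow, burau2_inv_pow]
  simp [-T_mul, syllable]

theorem burau_genericBraid (k : ℤ) {s : ℕ} (p q : Fin s → ℕ) :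
    (burau (genericBraid k p q) : Matrix (Fin 2) (Fin 2) ℤ[T;T⁻¹]).trace =
      (((-1 : ℤˣ) ^ k : ℤˣ) : ℤ) •
        (T (3 * k) * (List.ofFn fun i => syllable (p i) (q i)).prod.trace) := by
  have h : (burau (List.ofFn fun i : Fin s => sigma1 ^ (p i : ℤ) * sigma2 ^ (-(q i : ℤ))).prod :
      Matrix (Fin 2) (Fin 2) ℤ[T;T⁻¹]) = (List.ofFn fun i => syllable (p i) (q i)).prod := by
    rw [← Units.coeHom_apply, ← MonoidHom.comp_apply, map_list_prod, List.map_ofFn]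
    congr 2
    funext i
    exact burau_syllable _ _
  rw [genericBraid, map_mul, map_zpow, Units.val_mul, h, burau_fullTwist_zpow, smul_mul_assoc,
    smul_mul_assoc, one_mul, Matrix.trace_smul, Matrix.trace_smul, smul_eq_mul]

/-! ### The Jones polynomial of a closed braid -/

/-- The substitution `T 1 ↦ -A⁴`. -/
def negFourth : ℤ[T;T⁻¹] →+* ℤ[T;T⁻¹] :=
  eval₂ (Int.castRingHom _) ⟨-T 4, -T (-4), by
    rw [neg_mul_neg, T_mul_T_eq_one (by norm_num)], by
    rw [neg_mul_neg, T_mul_T_eq_one (by norm_num)]⟩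

theorem negFourth_T_one : negFourth (T 1) = -T 4 := by
  rw [negFourth, eval₂_T, zpow_one]

theorem negFourth_T_neg_one : negFourth (T (-1)) = -T (-4) := by
  rw [negFourth, eval₂_T, zpow_neg_one]; rfl

theorem negFourth_C_mul_T (a m : ℤ) :
    negFourth (C a * T m) = C ((((-1 : ℤˣ) ^ m : ℤˣ) : ℤ) * a) * T (4 * m) := by
  have hT : ∀ m : ℤ, negFourth (T m) = C (((-1 : ℤˣ) ^ m : ℤˣ) : ℤ) * T (4 * m) := by
    intro m
    induction m with
    | zero => simp
    | succ n ih =>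
      rw [T_add, map_mul, ih, negFourth_T_one, zpow_add_one, mul_add, T_add]
      simp [-T_mul]
      exact T_add _ _
    | pred n ih =>
      rw [sub_eq_add_neg, T_add, map_mul, ih, negFourth_T_neg_one, ← sub_eq_add_neg, zpow_sub_one,
        mul_sub, T_sub]
      simp [-T_mul]
      exact T_add _ _
  have hC : negFourth (C a) = C a := by
    rw [negFourth, eval₂_C]
    simp
  rw [map_mul, hT, hC, map_mul]
  ring

/-- The Kauffman resolution of a crossing is its Burau matrix at `-A⁴`, rescaled by `A` to the sign
of the crossing; these scalars accumulate to the writhe. -/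
theorem letterMatrix_eq (l : Fin 2 × Bool) :
    letterMatrix l = (T (if l.2 then -1 else 1) : ℤ[T;T⁻¹]) • negFourth.mapMatrix
      (cond l.2 (![burau1, burau2] l.1) (![burau1, burau2] l.1)⁻¹).val := by
  have h3 : (T 2 : ℤ[T;T⁻¹]) * T 1 = T 3 := by rw [← T_add]; rfl
  have h3' : (T (-2) : ℤ[T;T⁻¹]) * T (-1) = T (-3) := by rw [← T_add]; rfl
  have h1 : (T (-2) : ℤ[T;T⁻¹]) * T 1 = T (-1) := by rw [← T_add]; rfl
  have h1' : (T 2 : ℤ[T;T⁻¹]) * T (-1) = T 1 := by rw [← T_add]; rfl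
  have h4 : (T 4 : ℤ[T;T⁻¹]) * T (-1) = T 3 := by rw [← T_add]; rfl
  have h4' : (T (-4) : ℤ[T;T⁻¹]) * T 1 = T (-3) := by rw [← T_add]; rfl
  ext i j
  rcases l with ⟨x, _ | _⟩ <;> fin_cases x <;> fin_cases i <;> fin_cases j <;>
    simp [letterMatrix, tlMatrix, burau1, burau2, loopValue, negFourth_T_one,
      negFourth_T_neg_one, h3, h3', h1, h1', h4, h4', mul_sub] <;> ring_nf

theorem Word.prod_letterMatrix (w : Word) :
    (w.map letterMatrix).prod =
      (T w.writhe : ℤ[T;T⁻¹]) • negFourth.mapMatrix (burau w.toBraid).val := by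
  have h : burau w.toBraid =
      (w.map fun l => cond l.2 (![burau1, burau2] l.1) (![burau1, burau2] l.1)⁻¹).prod := by
    rw [← FreeGroup.lift_mk]
    rfl
  rw [h, Word.writhe]
  clear h
  induction w with
  | nil => simp
  | cons a w ih =>
    rw [List.map_cons, List.prod_cons, ih, letterMatrix_eq, List.map_cons, List.sum_cons, T_add,
      List.map_cons, List.prod_cons, Units.val_mul, map_mul, smul_mul_smul_comm]

/-- The Jones polynomial of a closed 3-braid, up to a unit, before the substitution
`T 1 ↦ -A⁴`. -/
def burauJones (b : BraidGroup) : ℤ[T;T⁻¹] :=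
  (burau b : Matrix (Fin 2) (Fin 2) ℤ[T;T⁻¹]).trace - T 1 - T (-1)

theorem burauJones_eq_of_isConj {b c : BraidGroup} (h : IsConj b c) :
    burauJones b = burauJones c := by
  obtain ⟨g, rfl⟩ := isConj_iff.1 h
  rw [burauJones, burauJones, map_mul, map_mul, map_inv, Units.val_mul, Units.val_mul,
    Matrix.trace_mul_comm, ← mul_assoc, Units.inv_mul, one_mul]

theorem Word.bracket_eq_burauJones (w : Word) :
    w.bracket = T w.writhe * negFourth (burauJones w.toBraid) := by
  rw [w.bracket_eq, w.prod_letterMatrix, Matrix.trace_smul, smul_eq_mul, burauJones, map_sub,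
    map_sub, negFourth_T_one, negFourth_T_neg_one]
  have : (negFourth.mapMatrix (burau w.toBraid).val).trace =
      negFourth (burau w.toBraid).val.trace := (AddMonoidHom.map_trace negFourth _).symm
  rw [this]
  ring

/-- The substitution `A = t^{-1/4}`. -/
abbrev substA (g : ℤ[T;T⁻¹]) : FracPoly :=
  AddMonoidAlgebra.mapDomain (fun n : ℤ => -(n : ℚ) / 4) g

theorem substA_negFourth_C_mul_T (ε n a m : ℤ) :
    substA (C ε * T n * negFourth (C a * T m)) =
      AddMonoidAlgebra.single (-(n : ℚ) / 4 - m) (ε * (((-1 : ℤˣ) ^ m : ℤˣ) : ℤ) * a) := by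
  have h : C ε * T n * negFourth (C a * T m) =
      AddMonoidAlgebra.single (n + 4 * m) (ε * (((-1 : ℤˣ) ^ m : ℤˣ) : ℤ) * a) := by
    rw [negFourth_C_mul_T, single_eq_C_mul_T, T_add, map_mul, map_mul, map_mul]
    ring
  rw [substA, h, AddMonoidAlgebra.mapDomain_single]
  congr 1
  push_cast
  ring

theorem coeff_substA_negFourth (ε n : ℤ) (g : ℤ[T;T⁻¹]) (m : ℤ) :
    (substA (C ε * T n * negFourth g)).coeff (-(n : ℚ) / 4 - m) =
      ε * (((-1 : ℤˣ) ^ m : ℤˣ) : ℤ) * g.coeff m := by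
  induction g using LaurentPolynomial.induction_on' with
  | add f g hf hg =>
    rw [map_add, mul_add, substA, AddMonoidAlgebra.mapDomain_add, AddMonoidAlgebra.coeff_add,
      Finsupp.add_apply, hf, hg, AddMonoidAlgebra.coeff_add, Finsupp.add_apply, mul_add]
  | C_mul_T l a =>
    rw [substA_negFourth_C_mul_T, ← single_eq_C_mul_T]
    by_cases h : l = m
    · subst h; simp [-single_eq_C_mul_T]
    · have : (-(n : ℚ) / 4 - l) ≠ -(n : ℚ) / 4 - m := by simpa using h
      simp [-single_eq_C_mul_T, h]

/-- All exponents lie in one coset of `ℤ` in `ℚ`, so no other rational exponent can compete for the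
extreme degree. -/
theorem exists_of_coeff_substA_negFourth_ne_zero (ε n : ℤ) (g : ℤ[T;T⁻¹]) (r : ℚ)
    (hr : (substA (C ε * T n * negFourth g)).coeff r ≠ 0) :
    ∃ m : ℤ, r = -(n : ℚ) / 4 - m := by
  by_contra! h
  refine hr ?_
  clear hr
  induction g using LaurentPolynomial.induction_on' with
  | add f g hf hg =>
    rw [map_add, mul_add, substA, AddMonoidAlgebra.mapDomain_add, AddMonoidAlgebra.coeff_add,
      Finsupp.add_apply, hf, hg, add_zero]
  | C_mul_T l a =>
    rw [substA_negFourth_C_mul_T, AddMonoidAlgebra.coeff_single,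
      Finsupp.single_apply, if_neg (h l).symm]

theorem Word.jones_eq (w : Word) : w.jones =
    substA (C (((-1 : ℤˣ) ^ (-3 * w.writhe) : ℤˣ) : ℤ) * T (-2 * w.writhe) *
      negFourth (burauJones w.toBraid)) := by
  rw [Word.jones, w.bracket_eq_burauJones, show -2 * w.writhe = -3 * w.writhe + w.writhe by ring,
    T_add]
  simp only [mul_assoc]

/-! ### Outer coefficients -/

/-- The coefficients of `J` are, up to sign, those of `g`, read backwards. -/
structure IsReversal (J : FracPoly) (c : ℚ) (g : ℤ → ℤ) : Prop where
  abs_coeff (m : ℤ) : |J.coeff (c - m)| = |g m|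
  exists_of_ne_zero (r : ℚ) : J.coeff r ≠ 0 → ∃ m : ℤ, r = c - m

theorem Word.isReversal_jones (w : Word) :
    ∃ c, IsReversal w.jones c fun m => (burauJones w.toBraid).coeff m := by
  refine ⟨-((-2 * w.writhe : ℤ) : ℚ) / 4, fun m => ?_, fun r hr => ?_⟩
  · rw [w.jones_eq, coeff_substA_negFourth, abs_mul, abs_mul,
      Int.isUnit_iff_abs_eq.1 (Units.isUnit _), Int.isUnit_iff_abs_eq.1 (Units.isUnit _), one_mul,
      one_mul]
  · rw [w.jones_eq] at hr
    exact exists_of_coeff_substA_negFourth_ne_zero _ _ _ _ hr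

theorem IsReversal.coeff_eq_zero {J : FracPoly} {c : ℚ} {g : ℤ → ℤ} (h : IsReversal J c g)
    {m : ℤ} (hm : g m = 0) : J.coeff (c - m) = 0 := by
  have := h.abs_coeff m
  rwa [hm, abs_zero, abs_eq_zero] at this

theorem IsReversal.coeff_ne_zero {J : FracPoly} {c : ℚ} {g : ℤ → ℤ} (h : IsReversal J c g)
    {m : ℤ} (hm : g m ≠ 0) : J.coeff (c - m) ≠ 0 := by
  rwa [← abs_ne_zero, h.abs_coeff, abs_ne_zero]

/-- As `A⁴ = t⁻¹`, the lowest exponent on the Burau side gives the highest power of `t`. -/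
theorem IsReversal.topDeg_eq {J : FracPoly} {c : ℚ} {g : ℤ → ℤ} (h : IsReversal J c g) {m : ℤ}
    (hm : g m ≠ 0) (hlt : ∀ n < m, g n = 0) : topDeg J = c - m := by
  have hmem : c - m ∈ J.coeff.support := Finsupp.mem_support_iff.2 (h.coeff_ne_zero hm)
  rw [topDeg, dif_pos ⟨_, hmem⟩]
  refine le_antisymm (Finset.max'_le _ _ _ fun r hr => ?_) (Finset.le_max' _ _ hmem)
  obtain ⟨n, rfl⟩ := h.exists_of_ne_zero r (Finsupp.mem_support_iff.1 hr)
  by_contra! hlt'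
  have hn : (n : ℚ) < m := by linarith
  exact Finsupp.mem_support_iff.1 hr (h.coeff_eq_zero (hlt n (by exact_mod_cast hn)))

theorem IsReversal.botDeg_eq {J : FracPoly} {c : ℚ} {g : ℤ → ℤ} (h : IsReversal J c g) {m : ℤ}
    (hm : g m ≠ 0) (hlt : ∀ n > m, g n = 0) : botDeg J = c - m := by
  have hmem : c - m ∈ J.coeff.support := Finsupp.mem_support_iff.2 (h.coeff_ne_zero hm)
  rw [botDeg, dif_pos ⟨_, hmem⟩]
  refine le_antisymm (Finset.min'_le _ _ hmem) (Finset.le_min' _ _ _ fun r hr => ?_)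
  obtain ⟨n, rfl⟩ := h.exists_of_ne_zero r (Finsupp.mem_support_iff.1 hr)
  by_contra! hlt'
  have hn : (m : ℚ) < n := by linarith
  exact Finsupp.mem_support_iff.1 hr (h.coeff_eq_zero (hlt n (by exact_mod_cast hn)))

theorem IsReversal.abs_zeta {J : FracPoly} {c : ℚ} {g : ℤ → ℤ} (h : IsReversal J c g) {m : ℤ}
    (hm : g m ≠ 0) (hlt : ∀ n < m, g n = 0) :
    |zeta J| = if |g m| = 1 then |g (m + 1)| else 0 := by
  rw [zeta, h.topDeg_eq hm hlt, h.abs_coeff,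
    show c - (m : ℚ) - 1 = c - ((m + 1 : ℤ) : ℚ) by push_cast; ring]
  split_ifs
  · exact h.abs_coeff _
  · exact abs_zero

theorem IsReversal.abs_zeta' {J : FracPoly} {c : ℚ} {g : ℤ → ℤ} (h : IsReversal J c g) {m : ℤ}
    (hm : g m ≠ 0) (hlt : ∀ n > m, g n = 0) :
    |zeta' J| = if |g m| = 1 then |g (m - 1)| else 0 := by
  rw [zeta', h.botDeg_eq hm hlt, h.abs_coeff,
    show c - (m : ℚ) + 1 = c - ((m - 1 : ℤ) : ℚ) by push_cast; ring]
  split_ifs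
  · exact h.abs_coeff _
  · exact abs_zero

/-! ### The outer coefficients of the trace of an alternating product -/

theorem geomPoly_coeff_zero {n : ℕ} (hn : 0 < n) : (geomPoly n).coeff 0 = 1 := by
  simp [geomPoly, Polynomial.coeff_X_pow, hn.ne']

theorem geomPoly_coeff_one (n : ℕ) : (geomPoly n).coeff 1 = if 1 < n then 1 else 0 := by
  simp [geomPoly, Polynomial.coeff_X_pow]

theorem geomPoly_succ' (n : ℕ) : geomPoly (n + 1) = 1 + Polynomial.X * geomPoly n := by
  rw [geomPoly, Finset.sum_range_succ', geomPoly, Finset.mul_sum, add_comm]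
  simp_rw [pow_succ', pow_zero]

theorem invert_toLaurent_geomPoly (n : ℕ) :
    invert (toLaurent (geomPoly n)) = T (-n) * toLaurent (Polynomial.X * geomPoly n) := by
  induction n with
  | zero => simp [geomPoly]
  | succ n ih =>
    have h : (T (-(n + 1 : ℕ)) : ℤ[T;T⁻¹]) * T 1 = T (-n) := by
      rw [← T_add]; congr 1; push_cast; ring
    rw [map_mul, Polynomial.toLaurent_X, ← mul_assoc, h]
    conv_rhs => rw [geomPoly_succ', map_add, mul_add, ← ih]
    rw [geomPoly_succ, map_add, map_add, toLaurent_X_pow, invert_T, map_one, mul_one, add_comm]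

/-- `syllable p q`, seen from the lowest exponent. -/
def lowMatrix (p q : ℕ) : Matrix (Fin 2) (Fin 2) ℤ[X] :=
  !![Polynomial.X ^ (p + q) + Polynomial.X * (geomPoly p * geomPoly q), geomPoly p;
    Polynomial.X * geomPoly q, 1]

/-- `syllable p q`, seen from the highest exponent. -/
def highMatrix (p q : ℕ) : Matrix (Fin 2) (Fin 2) ℤ[X] :=
  !![1 + Polynomial.X * (geomPoly p * geomPoly q), Polynomial.X ^ (q + 1) * geomPoly p;
    Polynomial.X ^ p * geomPoly q, Polynomial.X ^ (p + q)]

theorem syllable_eq_lowMatrix (p q : ℕ) :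
    syllable p q = (T (-q) : ℤ[T;T⁻¹]) • toLaurent.mapMatrix (lowMatrix p q) := by
  have h : (T p : ℤ[T;T⁻¹]) = T (-q) * T (p + q : ℕ) := by rw [← T_add]; congr 1; push_cast; ring
  refine Matrix.ext fun i j => ?_
  rw [syllable, invert_toLaurent_geomPoly, h]
  fin_cases i <;> fin_cases j <;>
    simp [-T_mul, -mul_T_assoc, lowMatrix] <;> ring

/-- The inversion of the variable. -/
abbrev invertHom : ℤ[T;T⁻¹] →+* ℤ[T;T⁻¹] := (invert (R := ℤ)).toRingEquiv.toRingHom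

theorem invertHom_syllable_eq_highMatrix (p q : ℕ) :
    invertHom.mapMatrix (syllable p q) =
      (T (-p) : ℤ[T;T⁻¹]) • toLaurent.mapMatrix (highMatrix p q) := by
  have h : (T q : ℤ[T;T⁻¹]) = T (-p) * T (p + q : ℕ) := by rw [← T_add]; congr 1; push_cast; ring
  have h' : (T (-p) : ℤ[T;T⁻¹]) * T p = 1 := T_mul_T_eq_one (by ring)
  have hi : ∀ g : ℤ[T;T⁻¹], invert (invert g) = g := involutive_invert
  have e00 : invertHom (T p + toLaurent (geomPoly p) * invert (toLaurent (geomPoly q))) =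
      T (-p) * toLaurent (1 + Polynomial.X * (geomPoly p * geomPoly q)) := by
    rw [map_add, map_mul]
    change invert (T p) + invert _ * invert (invert _) = _
    rw [hi, invert_T, invert_toLaurent_geomPoly]
    simp only [map_add, map_mul, map_one]
    ring
  have e01 : invertHom (toLaurent (geomPoly p) * T (-q)) =
      T (-p) * toLaurent (Polynomial.X ^ (q + 1) * geomPoly p) := by
    rw [map_mul]
    change invert _ * invert (T _) = _
    rw [invert_T, invert_toLaurent_geomPoly, neg_neg, pow_succ]
    simp only [map_mul, toLaurent_X_pow]
    ring
  have e10 : invertHom (invert (toLaurent (geomPoly q))) =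
      T (-p) * toLaurent (Polynomial.X ^ p * geomPoly q) := by
    change invert (invert _) = _
    rw [hi, map_mul, toLaurent_X_pow, ← mul_assoc, h', one_mul]
  have e11 : invertHom (T (-q)) = T (-p) * toLaurent (Polynomial.X ^ (p + q)) := by
    change invert (T _) = _
    rw [invert_T, neg_neg, toLaurent_X_pow, h]
  refine Matrix.ext fun i j => ?_
  fin_cases i <;> fin_cases j
  exacts [e00, e01, e10, e11]

theorem prod_ofFn_smul_mapMatrix {s : ℕ} (f : ℤ[T;T⁻¹] →+* ℤ[T;T⁻¹]) (n : Fin s → ℤ)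
    (M : Fin s → Matrix (Fin 2) (Fin 2) ℤ[T;T⁻¹]) (N : Fin s → Matrix (Fin 2) (Fin 2) ℤ[X])
    (h : ∀ i, f.mapMatrix (M i) = (T (n i) : ℤ[T;T⁻¹]) • toLaurent.mapMatrix (N i)) :
    f (List.ofFn M).prod.trace = T (∑ i, n i) * toLaurent (List.ofFn N).prod.trace := by
  have key : f.mapMatrix (List.ofFn M).prod =
      (T (∑ i, n i) : ℤ[T;T⁻¹]) • toLaurent.mapMatrix (List.ofFn N).prod := by
    induction s with
    | zero => simp
    | succ s ih =>
      rw [List.ofFn_succ, List.ofFn_succ, List.prod_cons, List.prod_cons, map_mul, map_mul, h,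
        ih _ _ _ fun i => h i.succ, Fin.sum_univ_succ, T_add, smul_mul_smul_comm]
  have h1 := AddMonoidHom.map_trace f (List.ofFn M).prod
  have h2 := AddMonoidHom.map_trace toLaurent (List.ofFn N).prod
  rw [h1, h2, ← smul_eq_mul, ← Matrix.trace_smul]
  exact congrArg Matrix.trace key

/-- The first two coefficients of the entries of a product of `s` matrices `highMatrix`. -/
theorem coeff_prod_highMatrix {s : ℕ} (p q : Fin (s + 1) → ℕ) (hp : ∀ i, 0 < p i)
    (hq : ∀ i, 0 < q i) :
    let N := (List.ofFn fun i => highMatrix (p i) (q i)).prod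
    (N 0 0).coeff 0 = 1 ∧ (N 0 0).coeff 1 = s + 1 ∧ (N 0 1).coeff 0 = 0 ∧ (N 0 1).coeff 1 = 0 ∧
      (N 1 0).coeff 0 = 0 ∧ (N 1 1).coeff 0 = 0 ∧ (N 1 1).coeff 1 = 0 := by
  have base : ∀ p q : ℕ, 0 < p → 0 < q →
      ((highMatrix p q) 0 0).coeff 0 = 1 ∧ ((highMatrix p q) 0 0).coeff 1 = 1 ∧
      ((highMatrix p q) 0 1).coeff 0 = 0 ∧ ((highMatrix p q) 0 1).coeff 1 = 0 ∧
      ((highMatrix p q) 1 0).coeff 0 = 0 ∧ ((highMatrix p q) 1 1).coeff 0 = 0 ∧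
      ((highMatrix p q) 1 1).coeff 1 = 0 := by
    intro p q hp hq
    have h0 : ¬ 0 = p + q := by omega
    have h1 : ¬ 1 = p + q := by omega
    simp [highMatrix, Polynomial.mul_coeff_one, Polynomial.coeff_X_pow, Polynomial.coeff_one,
      geomPoly_coeff_zero hp, geomPoly_coeff_zero hq, hp.ne, hq.ne', h0, h1]
  -- Modulo `X` every factor is the idempotent with single entry 1 at `(0, 0)`, and each factor adds
  -- 1 to the linear coefficient there. The linear coefficient at `(1, 0)` is not tracked, since it
  -- only meets entries at `(0, 1)`, which vanish to second order. The induction starts at one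
  -- factor because the empty product has constant term 1 at `(1, 1)`.
  induction s with
  | zero =>
    have := base (p 0) (q 0) (hp 0) (hq 0)
    simpa [List.ofFn_succ] using this
  | succ s ih =>
    obtain ⟨a0, a1, b0, b1, c0, d0, d1⟩ := base (p 0) (q 0) (hp 0) (hq 0)
    obtain ⟨a0', a1', b0', b1', c0', d0', d1'⟩ := ih (fun i => p i.succ) (fun i => q i.succ)
      (fun i => hp _) (fun i => hq _)
    rw [List.ofFn_succ, List.prod_cons]
    simp only [Matrix.mul_apply, Fin.sum_univ_two, Polynomial.coeff_add, Polynomial.mul_coeff_zero,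
      Polynomial.mul_coeff_one, a0, a1, b0, b1, c0, d0, d1, a0', a1', b0', b1', c0', d0', d1']

    simp [add_comm]

/-- The first two coefficients of the entries of a product of `s` matrices `lowMatrix`. -/
theorem coeff_prod_lowMatrix {s : ℕ} (p q : Fin (s + 1) → ℕ) (hp : ∀ i, 0 < p i)
    (hq : ∀ i, 0 < q i) :
    let N := (List.ofFn fun i => lowMatrix (p i) (q i)).prod
    (N 0 0).coeff 0 = 0 ∧ (N 0 0).coeff 1 = 1 ∧ (N 0 1).coeff 0 = 1 ∧
      (N 1 0).coeff 0 = 0 ∧ (N 1 0).coeff 1 = 1 ∧ (N 1 1).coeff 0 = 1 ∧ (N 1 1).coeff 1 = s := by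
  have base : ∀ p q : ℕ, 0 < p → 0 < q →
      ((lowMatrix p q) 0 0).coeff 0 = 0 ∧ ((lowMatrix p q) 0 0).coeff 1 = 1 ∧
      ((lowMatrix p q) 0 1).coeff 0 = 1 ∧
      ((lowMatrix p q) 1 0).coeff 0 = 0 ∧ ((lowMatrix p q) 1 0).coeff 1 = 1 ∧
      ((lowMatrix p q) 1 1).coeff 0 = 1 ∧ ((lowMatrix p q) 1 1).coeff 1 = 0 := by
    intro p q hp hq
    have h0 : ¬ 0 = p + q := by omega
    have h1 : ¬ 1 = p + q := by omega
    simp [lowMatrix, Polynomial.mul_coeff_one, Polynomial.coeff_X_pow, Polynomial.coeff_one,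
      geomPoly_coeff_zero hp, geomPoly_coeff_zero hq, h0, h1]
  -- Modulo `X` every factor is the idempotent with rows `(0, 1)` and `(0, 1)`. The linear
  -- coefficient at `(1, 1)` grows through the product of the entries at `(1, 0)` and `(0, 1)`;
  -- since the former has no constant term, the linear coefficient of the latter is never needed.
  induction s with
  | zero =>
    have := base (p 0) (q 0) (hp 0) (hq 0)
    simpa [List.ofFn_succ] using this
  | succ s ih =>
    obtain ⟨a0, a1, b0, c0, c1, d0, d1⟩ := base (p 0) (q 0) (hp 0) (hq 0)
    obtain ⟨a0', a1', b0', c0', c1', d0', d1'⟩ := ih (fun i => p i.succ) (fun i => q i.succ)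
      (fun i => hp _) (fun i => hq _)
    rw [List.ofFn_succ, List.prod_cons]
    simp only [Matrix.mul_apply, Fin.sum_univ_two, Polynomial.coeff_add, Polynomial.mul_coeff_zero,
      Polynomial.mul_coeff_one, a0, a1, b0, c0, c1, d0, d1, a0', a1', b0', c0', c1', d0', d1']

    simp [add_comm]

/-- For a single syllable both ends of the trace give this polynomial. Its third coefficient matters
only when the leading term cancels against `T` or `T⁻¹`. -/
theorem syllable_trace_coeff_two {p q : ℕ} (hp : 0 < p) (hq : 0 < q) :
    0 ≤ (1 + Polynomial.X * (geomPoly p * geomPoly q) + Polynomial.X ^ (p + q)).coeff 2 ∧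
      (1 + Polynomial.X * (geomPoly p * geomPoly q) + Polynomial.X ^ (p + q)).coeff 2 ≤ 2 := by
  rw [Polynomial.coeff_add, Polynomial.coeff_add, Polynomial.coeff_X_mul, Polynomial.mul_coeff_one,
    geomPoly_coeff_zero hp, geomPoly_coeff_zero hq, geomPoly_coeff_one, geomPoly_coeff_one,
    Polynomial.coeff_X_pow, Polynomial.coeff_one]
  split_ifs <;> first | omega | contradiction

theorem coeff_trace_prod_highMatrix {s : ℕ} (p q : Fin s → ℕ) (hs : 0 < s) (hp : ∀ i, 0 < p i)
    (hq : ∀ i, 0 < q i) :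
    let P := (List.ofFn fun i => highMatrix (p i) (q i)).prod.trace
    P.coeff 0 = 1 ∧ P.coeff 1 = s ∧ (s = 1 → 0 ≤ P.coeff 2 ∧ P.coeff 2 ≤ 2) := by
  obtain ⟨s, rfl⟩ := Nat.exists_eq_succ_of_ne_zero hs.ne'
  obtain ⟨a0, a1, b0, b1, c0, d0, d1⟩ := coeff_prod_highMatrix p q hp hq
  refine ⟨?_, ?_, ?_⟩
  · rw [Matrix.trace_fin_two, Polynomial.coeff_add, a0, d0, add_zero]
  · rw [Matrix.trace_fin_two, Polynomial.coeff_add, a1, d1, add_zero, Nat.cast_succ]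
  · intro h
    obtain rfl : s = 0 := by omega
    have : (List.ofFn fun i => highMatrix (p i) (q i)).prod.trace =
        1 + Polynomial.X * (geomPoly (p 0) * geomPoly (q 0)) + Polynomial.X ^ (p 0 + q 0) := by
      simp [List.ofFn_succ, highMatrix, Matrix.trace_fin_two]
    rw [this]
    exact syllable_trace_coeff_two (hp 0) (hq 0)

theorem coeff_trace_prod_lowMatrix {s : ℕ} (p q : Fin s → ℕ) (hs : 0 < s) (hp : ∀ i, 0 < p i)
    (hq : ∀ i, 0 < q i) :
    let P := (List.ofFn fun i => lowMatrix (p i) (q i)).prod.trace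
    P.coeff 0 = 1 ∧ P.coeff 1 = s ∧ (s = 1 → 0 ≤ P.coeff 2 ∧ P.coeff 2 ≤ 2) := by
  obtain ⟨s, rfl⟩ := Nat.exists_eq_succ_of_ne_zero hs.ne'
  obtain ⟨a0, a1, b0, c0, c1, d0, d1⟩ := coeff_prod_lowMatrix p q hp hq
  refine ⟨?_, ?_, ?_⟩
  · rw [Matrix.trace_fin_two, Polynomial.coeff_add, a0, d0, zero_add]
  · rw [Matrix.trace_fin_two, Polynomial.coeff_add, a1, d1, Nat.cast_succ, add_comm]
  · intro h
    obtain rfl : s = 0 := by omega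
    have : (List.ofFn fun i => lowMatrix (p i) (q i)).prod.trace =
        1 + Polynomial.X * (geomPoly (p 0) * geomPoly (q 0)) + Polynomial.X ^ (p 0 + q 0) := by
      simp [List.ofFn_succ, lowMatrix, Matrix.trace_fin_two]
      ring
    rw [this]
    exact syllable_trace_coeff_two (hp 0) (hq 0)

theorem coeff_toLaurent_natCast (P : ℤ[X]) (n : ℕ) : (toLaurent P).coeff n = P.coeff n := by
  rw [coeff_toLaurent]
  exact Finsupp.mapDomain_apply Nat.castEmbedding.injective _ _

theorem coeff_toLaurent_of_neg (P : ℤ[X]) {n : ℤ} (hn : n < 0) : (toLaurent P).coeff n = 0 := by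
  rw [coeff_toLaurent]
  refine Finsupp.mapDomain_of_notMem_range _ _ ?_
  rintro ⟨m, rfl⟩
  exact absurd hn (by simp)

theorem coeff_T_mul (m : ℤ) (g : ℤ[T;T⁻¹]) (n : ℤ) : (T m * g).coeff n = g.coeff (n - m) := by
  rw [T, AddMonoidAlgebra.coeff_single_mul_eq_mul_coeff (n - m) fun _ _ => by omega, one_mul]

/-- `Y` starts in degree `-Q` with the coefficients `1, s`, and for `s = 1` the next coefficient is
between `0` and `2`. -/
structure HasLowCoeffs (Y : ℤ → ℤ) (Q : ℤ) (s : ℕ) : Prop where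
  below (n : ℤ) : n < -Q → Y n = 0
  coeff_zero : Y (-Q) = 1
  coeff_one : Y (-Q + 1) = s
  coeff_two : s = 1 → 0 ≤ Y (-Q + 2) ∧ Y (-Q + 2) ≤ 2

theorem hasLowCoeffs_of_eq {g : ℤ[T;T⁻¹]} {P : ℤ[X]} {Q : ℤ} {s : ℕ}
    (h : g = T (-Q) * toLaurent P)
    (hP : P.coeff 0 = 1 ∧ P.coeff 1 = s ∧ (s = 1 → 0 ≤ P.coeff 2 ∧ P.coeff 2 ≤ 2)) :
    HasLowCoeffs (fun n => g.coeff n) Q s := by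
  subst h
  have hn (n : ℕ) : (T (-Q) * toLaurent P).coeff (-Q + n) = P.coeff n := by
    rw [coeff_T_mul, add_sub_cancel_left, coeff_toLaurent_natCast]
  refine ⟨fun n hlt => ?_, ?_, ?_, fun hs => ?_⟩
  · rw [coeff_T_mul, coeff_toLaurent_of_neg]
    omega
  · simpa [hP.1] using hn 0
  · simpa [hP.2.1] using hn 1
  · have := hn 2
    simp only [Nat.cast_ofNat] at this
    simpa only [this] using hP.2.2 hs

/-- Everything depends on where the lowest exponent `b = 3k - Q` of the shifted `Y` lies relative to
the exponent `-1` of the correction term. -/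
theorem exists_lowest {Y c : ℤ → ℤ} {Q k : ℤ} {s : ℕ} (hs : 0 < s) (hY : HasLowCoeffs Y Q s)
    (u : ℤˣ) (hc : ∀ m, c m = u * Y (m - 3 * k) - (if m = 1 then 1 else 0) -
      (if m = -1 then 1 else 0)) :
    ∃ m, c m ≠ 0 ∧ (∀ n < m, c n = 0) ∧ (if |c m| = 1 then |c (m + 1)| else 0) ≤ (s : ℤ) + 1 ∧
      (3 * k - Q ≤ -2 → (s : ℤ) - 1 ≤ if |c m| = 1 then |c (m + 1)| else 0) := by
  obtain ⟨below, h0, h1, h2⟩ := hY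
  have hlow : ∀ n < 3 * k - Q, n < -1 → c n = 0 := by
    intro n hn hn'
    rw [hc, below _ (by omega), if_neg (by omega), if_neg (by omega)]
    simp
  have hc0 : c (3 * k - Q) = u - (if 3 * k - Q = 1 then 1 else 0) -
      (if 3 * k - Q = -1 then 1 else 0) := by
    rw [hc, show 3 * k - Q - 3 * k = -Q by ring, h0, mul_one]
  have hc1 : c (3 * k - Q + 1) = u * s - (if 3 * k - Q + 1 = 1 then 1 else 0) -
      (if 3 * k - Q + 1 = -1 then 1 else 0) := by
    rw [hc, show 3 * k - Q + 1 - 3 * k = -Q + 1 by ring, h1]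
  have hc2 : c (3 * k - Q + 2) = u * Y (-Q + 2) - (if 3 * k - Q + 2 = 1 then 1 else 0) -
      (if 3 * k - Q + 2 = -1 then 1 else 0) := by
    rw [hc, show 3 * k - Q + 2 - 3 * k = -Q + 2 by ring]
  have hs' : (1 : ℤ) ≤ s := by exact_mod_cast hs
  generalize hb : 3 * k - Q = b at *
  rcases lt_or_ge b (-1) with hlt | hge
  -- The leading coefficient is `±1`; the next is `±s`, lowered by 1 exactly when `b = -2`.
  · rw [if_neg (by omega), if_neg (by omega)] at hc0
    rw [if_neg (by omega)] at hc1
    have h0' : |c b| = 1 := by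
      rw [hc0, sub_zero, sub_zero, Int.isUnit_iff_abs_eq.1 (Units.isUnit _)]
    refine ⟨b, by rw [← abs_ne_zero, h0']; simp, fun n hn => hlow n hn (by omega), ?_, fun _ => ?_⟩
    · rw [if_pos h0', abs_le]
      rcases Int.units_eq_one_or u with rfl | rfl <;> simp at hc1 <;> split_ifs at hc1 <;> omega
    · rw [if_pos h0', le_abs]
      rcases Int.units_eq_one_or u with rfl | rfl <;> simp at hc1 <;> split_ifs at hc1 <;> omega
  · rcases hge.eq_or_lt with hb1 | hgt
    · subst hb1
      simp at hc0 hc1 hc2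
      rcases Int.units_eq_one_or u with rfl | rfl
      -- The leading term cancels `T⁻¹`, so the coefficient `s` at exponent 0 leads. It is `±1` only
      -- for `s = 1`, and then the next coefficient is that of `Y` less 1, hence between `-1` and
      -- `1`.
      · refine ⟨0, ?_, fun n hn => ?_, ?_, fun h => by omega⟩
        · simp [hc1]; omega
        · rcases (show n < -1 ∨ n = -1 by omega) with h | rfl
          · exact hlow n h h
          · simp [hc0]
        · by_cases h : s = 1
          · have := h2 h
            subst h
            simp [hc1, hc2]
            grind
          · rw [if_neg]
            · positivity
            · simp [hc1]; omega
      -- The leading coefficient is `-2`, so the value is 0 by convention.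
      · refine ⟨-1, by simp [hc0], fun n hn => hlow n hn hn, ?_, fun h => by omega⟩
        simp [hc0]
        positivity
    -- Now `-T⁻¹` leads, and the coefficient after it is `±1` or 0 according as `b = 0` or `b > 0`.
    · have hm : c (-1) = -1 := by
        rw [hc, below _ (by omega)]
        simp
      refine ⟨-1, by simp [hm], fun n hn => hlow n (by omega) hn, ?_, fun h => by omega⟩
      rcases (show (0 : ℤ) = b ∨ 0 < b by omega) with rfl | hpos
      · simp at hc0
        rcases Int.units_eq_one_or u with rfl | rfl <;> simp [hm, hc0]
      · have h0 : c 0 = 0 := by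
          rw [hc, below _ (by omega)]
          simp
        simp [hm, h0]
        positivity

theorem coeff_burauJones_genericBraid (k : ℤ) {s : ℕ} (p q : Fin s → ℕ) (m : ℤ) :
    (burauJones (genericBraid k p q)).coeff m =
      (((-1 : ℤˣ) ^ k : ℤˣ) : ℤ) *
        (List.ofFn fun i => syllable (p i) (q i)).prod.trace.coeff (m - 3 * k) -
        (if m = 1 then 1 else 0) - (if m = -1 then 1 else 0) := by
  rw [burauJones, burau_genericBraid]
  simp only [AddMonoidAlgebra.coeff_sub, Finsupp.sub_apply, AddMonoidAlgebra.coeff_smul,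
    Finsupp.smul_apply, smul_eq_mul, coeff_T_mul, T_apply, eq_comm]

theorem hasLowCoeffs_trace {s : ℕ} (hs : 0 < s) (p q : Fin s → ℕ) (hp : ∀ i, 0 < p i)
    (hq : ∀ i, 0 < q i) :
    HasLowCoeffs (fun n => (List.ofFn fun i => syllable (p i) (q i)).prod.trace.coeff n)
      (∑ i, (q i : ℤ)) s := by
  refine hasLowCoeffs_of_eq ?_ (coeff_trace_prod_lowMatrix p q hs hp hq)
  rw [← Finset.sum_neg_distrib]
  exact prod_ofFn_smul_mapMatrix (RingHom.id _) _ _ _ fun i => by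
    rw [RingHom.mapMatrix_id]
    exact syllable_eq_lowMatrix _ _

theorem hasLowCoeffs_trace_neg {s : ℕ} (hs : 0 < s) (p q : Fin s → ℕ) (hp : ∀ i, 0 < p i)
    (hq : ∀ i, 0 < q i) :
    HasLowCoeffs (fun n => (List.ofFn fun i => syllable (p i) (q i)).prod.trace.coeff (-n))
      (∑ i, (p i : ℤ)) s := by
  simp only [← invert_apply]
  refine hasLowCoeffs_of_eq ?_ (coeff_trace_prod_highMatrix p q hs hp hq)
  rw [← Finset.sum_neg_distrib]
  exact prod_ofFn_smul_mapMatrix invertHom _ _ _ fun i => invertHom_syllable_eq_highMatrix _ _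

/-- The bounds for the outer coefficients of the Jones polynomial of a generic closed 3-braid. -/
theorem max_abs_zeta_bounds (k : ℤ) (s : ℕ) (hs : 0 < s) (p q : Fin s → ℕ)
    (hp : ∀ i, 0 < p i) (hq : ∀ i, 0 < q i)
    (w : Word) (hw : IsConj w.toBraid (genericBraid k p q)) :
    (s : ℤ) - 1 ≤ max |zeta w.jones| |zeta' w.jones| ∧
      max |zeta w.jones| |zeta' w.jones| ≤ (s : ℤ) + 1 := by
  obtain ⟨c, hJ⟩ := w.isReversal_jones
  rw [burauJones_eq_of_isConj hw] at hJ
  have hcoeff := coeff_burauJones_genericBraid k p q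
  obtain ⟨m, hm, hlow, hle, hge⟩ := exists_lowest hs (hasLowCoeffs_trace hs p q hp hq) _ hcoeff
  -- Replacing `T` by `T⁻¹` preserves `T + T⁻¹`, turns `k` into `-k` and exchanges the roles of `pᵢ`
  -- and `qᵢ`, so the upper end is another lowest end.
  obtain ⟨m', hm', hlow', hle', hge'⟩ := exists_lowest (k := -k)
    (c := fun m => (burauJones (genericBraid k p q)).coeff (-m)) hs
    (hasLowCoeffs_trace_neg hs p q hp hq) ((-1) ^ k) (fun m => by
      rw [hcoeff, show -m - 3 * k = -(m - 3 * -k) by ring, sub_right_comm]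
      simp only [neg_eq_iff_eq_neg, neg_neg])
  rw [show -(m' + 1) = -m' - 1 by ring] at hle' hge'
  rw [← hJ.abs_zeta hm hlow] at hle hge
  rw [← hJ.abs_zeta' hm' fun n hn => by simpa using hlow' (-n) (by omega)] at hle' hge'
  refine ⟨?_, max_le hle hle'⟩
  rcases Nat.lt_or_ge s 2 with h1 | h2
  · exact le_max_of_le_left (le_trans (by omega) (abs_nonneg _))
  · have hP : (s : ℤ) ≤ ∑ i, (p i : ℤ) := by
      simpa using Finset.sum_le_sum (s := Finset.univ) (f := fun _ : Fin s => (1 : ℤ))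
        fun i _ => (by exact_mod_cast hp i : (1 : ℤ) ≤ p i)
    have hQ : (s : ℤ) ≤ ∑ i, (q i : ℤ) := by
      simpa using Finset.sum_le_sum (s := Finset.univ) (f := fun _ : Fin s => (1 : ℤ))
        fun i _ => (by exact_mod_cast hq i : (1 : ℤ) ≤ q i)
    -- If `3k - Q ≥ -1`, then `-3k - P ≤ 1 - P - Q ≤ 1 - 2s ≤ -3`, so the other end attains the
    -- lower bound.
    by_cases h : 3 * k - ∑ i, (q i : ℤ) ≤ -2
    · exact le_max_of_le_left (hge h)
    · exact le_max_of_le_right (hge' (by omega))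

end ThreeBraid

end

/-- Let `K` be the closure of a 3-braid that is conjugate to
`C^k σ₁^{p₁} σ₂^{-q₁} ⋯ σ₁^{pₛ} σ₂^{-qₛ}` with `s, pᵢ, qᵢ > 0`, given by any braid word `w` for it.
Then `s - 1 ≤ max {|ζ_K|, |ζ'_K|} ≤ s + 1`. -/
theorem proposition6p5 (k : ℤ) (s : ℕ) (hs : 0 < s) (p q : Fin s → ℕ)
    (hp : ∀ i, 0 < p i) (hq : ∀ i, 0 < q i)
    (w : ThreeBraid.Word) (hw : IsConj w.toBraid (ThreeBraid.genericBraid k p q)) :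
    (s : ℤ) - 1 ≤ max |ThreeBraid.zeta w.jones| |ThreeBraid.zeta' w.jones| ∧
      max |ThreeBraid.zeta w.jones| |ThreeBraid.zeta' w.jones| ≤ (s : ℤ) + 1 :=
  ThreeBraid.max_abs_zeta_bounds k s hs p q hp hq w hw
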